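/- Let $(X,\mathsf d)$ be a proper geodesic metric space and $\mathfrak m$ a Borel probability measure on $X$. Let $\mathrm{Geo}(X)$ be the set of $\gamma:[0,1]\to X$ with $\mathsf d(\gamma_s,\gamma_t)=|s-t|\,\mathsf d(\gamma_0,\gamma_1)$ for all $s,t$. Assume that $X$ is non-branching: if $\gamma^1,\gamma^2\in\mathrm{Geo}(X)$ satisfy $\gamma^1_0=\gamma^2_0$ and $\gamma^1_t=\gamma^2_t$ for some $t\in(0,1)$, then $\gamma^1_1=\gamma^2_1$. Let $\mu_0,\mu_1$ be Borel probability measures on $X$ with finite first moment, with $\mu_0\ll\mathfrak m$, and let $\Pi(\mu_0,\mu_1)$ be the set of measures on $X\times X$ with marginals $\mu_0,\mu_1$. Let $\varphi:X\to\mathbb R$ be a Kantorovich potential for $(\mu_0,\mu_1)$: $\varphi$ is $1$-Lipschitz and, with $\Gamma:=\{(x,y):\varphi(x)-\varphi(y)=\mathsf d(x,y)\}$, a plan $\pi\in\Pi(\mu_0,\mu_1)$ minimizes $\int\mathsf d\,d\pi$ over $\Pi(\mu_0,\mu_1)$ if and only if $\pi(\Gamma)=1$. Put $\Gamma^{-1}:=\{(x,y):(y,x)\in\Gamma\}$,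 $R:=\Gamma\cup\Gamma^{-1}$, and $$\mathcal T_e:=\{x:\exists\,y\neq x,\ (x,y)\in R\},\qquad A_+:=\{x\in\mathcal T_e:\exists z,w,\ (x,z),(x,w)\in\Gamma,\ (z,w)\notin R\},$$ $$A_-:=\{x\in\mathcal T_e:\exists z,w,\ (x,z),(x,w)\in\Gamma^{-1},\ (z,w)\notin R\},\qquad \mathcal T:=\mathcal T_e\setminus(A_+\cup A_-).$$ For $C\subset\mathcal T_e$ and $t\in\mathbb R$ let $C_t$ be the set of $y\in\mathcal T$ for which there is $x\in C$ with $\mathsf d(x,y)=|t|$ and $(x,y)\in\Gamma$ if $t\ge0$, $(y,x)\in\Gamma$ if $t\le0$ (translation by $t$ along the rays). Assume (A.1) for every compact $C\subset\mathcal T_e$ with $\mathfrak m(C)>0$ one has $\mathfrak m(C_t)>0$ for uncountably many $t\in\mathbb R$. Then there is a Borel map $T:X\to X$ with $T_\sharp\mu_0=\mu_1$ solving the Monge problem: $$\int_X\mathsf d(x,T(x))\,\mu_0(dx)=\min_{\pi\in\Pi(\mu_0,\mu_1)}\int_{X\times X}\mathsf d(x,y)\,\pi(dx\,dy).$$ Moreover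 $T$ can be chosen monotone along the rays: there is $E\subset X$ of full $\mu_0$-measure such that $(x,T(x))\in\Gamma$ for all $x\in E$, and $(T(x),T(x'))\in\Gamma$ whenever $x,x'\in E$ and $(x,x')\in\Gamma$. -/

import Mathlib

open MeasureTheory

namespace L1Transport

section Geometry

variable {X : Type*} [MetricSpace X]

/-- `γ ∈ Geo(X)`: a constant speed minimizing geodesic parametrized by `[0,1]`
(continuity is automatic from the defining identity). -/
def IsGeodesic (γ : unitInterval → X) : Prop :=
  ∀ s t : unitInterval, dist (γ s) (γ t) = |(s : ℝ) - (t : ℝ)| * dist (γ 0) (γ 1)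

variable (X) in
/-- Any two points are joined by a geodesic. -/
def GeodesicSpace : Prop :=
  ∀ x y : X, ∃ γ : unitInterval → X, IsGeodesic γ ∧ γ 0 = x ∧ γ 1 = y

variable (X) in
/-- Two geodesics with the same starting point that meet at the same intermediate time have the
same final point. -/
def NonBranching : Prop :=
  ∀ γ₁ γ₂ : unitInterval → X, IsGeodesic γ₁ → IsGeodesic γ₂ → γ₁ 0 = γ₂ 0 →
    (∃ t : unitInterval, 0 < t ∧ t < 1 ∧ γ₁ t = γ₂ t) → γ₁ 1 = γ₂ 1

/-- `Γ`: the pairs of points moved by `φ` with maximal slope. -/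
def Gam (φ : X → ℝ) : Set (X × X) := {p | φ p.1 - φ p.2 = dist p.1 p.2}

/-- `Γ⁻¹`. -/
def GamInv (φ : X → ℝ) : Set (X × X) := {p | (p.2, p.1) ∈ Gam φ}

/-- `R = Γ ∪ Γ⁻¹`, the set of transport rays. -/
def Rays (φ : X → ℝ) : Set (X × X) := Gam φ ∪ GamInv φ

/-- `𝒯ₑ`, the transport set with end points. -/
def transportSetEnd (φ : X → ℝ) : Set X :=
  Prod.fst '' (Gam φ \ Set.diagonal X) ∪ Prod.fst '' (GamInv φ \ Set.diagonal X)

/-- `A₊`, the forward branching points. -/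
def branchForward (φ : X → ℝ) : Set X :=
  {x | x ∈ transportSetEnd φ ∧ ∃ z w, (x, z) ∈ Gam φ ∧ (x, w) ∈ Gam φ ∧ (z, w) ∉ Rays φ}

/-- `A₋`, the backward branching points. -/
def branchBackward (φ : X → ℝ) : Set X :=
  {x | x ∈ transportSetEnd φ ∧
    ∃ z w, (x, z) ∈ GamInv φ ∧ (x, w) ∈ GamInv φ ∧ (z, w) ∉ Rays φ}

/-- `𝒯 = 𝒯ₑ \ (A₊ ∪ A₋)`, the transport set. -/
def transportSet (φ : X → ℝ) : Set X :=
  transportSetEnd φ \ (branchForward φ ∪ branchBackward φ)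

/-- `C_t`, the `t`-translation of `C`: the points of the transport set `𝒯` reached from a point
of `C` by moving a distance `|t|` along a ray, forward (in the direction of `Γ`) if `t ≥ 0` and
backward if `t ≤ 0`. On `𝒯` each ray `X_q` is parametrized by arc length by the ray map
`s ↦ g (q, s)`, increasing in the direction of `Γ`; so for `C ⊆ 𝒯` this set is
`g {(q, s + t) | (q, s) ∈ g⁻¹ C}`, whatever the choice of the base points `q`. -/
def translation (φ : X → ℝ) (C : Set X) (t : ℝ) : Set X :=
  {y | y ∈ transportSet φ ∧ ∃ x ∈ C,
    (0 ≤ t ∧ (x, y) ∈ Gam φ ∧ dist x y = t) ∨ (t ≤ 0 ∧ (y, x) ∈ Gam φ ∧ dist x y = -t)}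

end Geometry

section Transport

variable {X : Type*} [MetricSpace X] [MeasurableSpace X]

/-- Assumption (A.1): every compact set of positive measure of points moved by `φ` has
translations of positive measure for uncountably many times. -/
def AssumptionA1 (m : Measure X) (φ : X → ℝ) : Prop :=
  ∀ C : Set X, IsCompact C → C ⊆ transportSetEnd φ → 0 < m C →
    ¬ {t : ℝ | 0 < m (translation φ C t)}.Countable

/-- `μ` has finite first moment. -/
def FiniteFirstMoment (μ : Measure X) : Prop :=
  ∃ x₀ : X, Integrable (fun x => dist x₀ x) μ

/-- `Π(μ₀, μ₁)`: the transport plans, i.e. the measures on `X × X` with marginals `μ₀`, `μ₁`. -/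
def plans (μ₀ μ₁ : Measure X) : Set (Measure (X × X)) :=
  {π | π.map Prod.fst = μ₀ ∧ π.map Prod.snd = μ₁}

/-- The cost `∫ d(x,y) π(dx dy)` of a plan. -/
noncomputable def cost (π : Measure (X × X)) : ENNReal :=
  ∫⁻ p, edist p.1 p.2 ∂π

/-- `π` is an optimal transport plan from `μ₀` to `μ₁`. -/
def IsOptimalPlan (μ₀ μ₁ : Measure X) (π : Measure (X × X)) : Prop :=
  π ∈ plans μ₀ μ₁ ∧ ∀ π' ∈ plans μ₀ μ₁, cost π ≤ cost π'

/-- `φ` is a Kantorovich potential for `(μ₀, μ₁)`: it is `1`-Lipschitz, and a transport plan is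
optimal if and only if it is concentrated on `Γ`. -/
def IsKantorovichPotential (μ₀ μ₁ : Measure X) (φ : X → ℝ) : Prop :=
  LipschitzWith 1 φ ∧ ∀ π ∈ plans μ₀ μ₁, (IsOptimalPlan μ₀ μ₁ π ↔ π (Gam φ) = 1)

end Transport

end L1Transport

namespace L1Transport

/-! ### Geometry of the rays. -/

section Geometry

variable {X : Type*} [MetricSpace X] {φ : X → ℝ} {x y z w : X}

/-! On `𝒯` the relation `R` is transitive (`Rays_trans`), and `φ` maps each ray isometrically into
`ℝ`. A Borel cross-section `Q` of the rays (`exists_rayBase`) thus gives coordinates `(Q x, φ x)`,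
and the Monge problem becomes a family of problems on the line. An optimal plan exists by
compactness and lives on `Γ`, so in coordinates it is a law of triples `(q, s, t)` with `t ≤ s`.
After disintegration in `q`, the monotone rearrangement of each fibre is a map, provided that the
first marginals of the fibres have no atoms. It moves points down because `t ≤ s` orders the
distribution functions (`exists_fibrewise_rearrangement`).

Assumption (A.1) supplies the missing smallness (`measure_eq_zero_of_subsingleton_rays`). If a Borel
set meets each ray at most once, its translations are pairwise disjoint, and a finite measure
charges only countably many of them, so the set is null. This applies to `A₊` and `A₋`, since
non-branching forces a branching point to be an end of its rays. It also applies to the graphs `φ =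
f ∘ Q`. The latter exclude atoms: an atom of a fibre is one of its rational quantiles, and these
form countably many Borel graphs.

The resulting map keeps points on their rays and moves them along `Γ`, so the plan it induces is
concentrated on `Γ`, hence optimal. -/

theorem mem_Gam : (x, y) ∈ Gam φ ↔ φ x - φ y = dist x y := Iff.rfl

theorem mem_Rays : (x, y) ∈ Rays φ ↔ dist x y = |φ x - φ y| := by
  simp only [Rays, GamInv, Gam, Set.mem_union, Set.mem_ofPred_eq]
  constructor
  · rintro (h | h)
    · rw [h, abs_of_nonneg dist_nonneg]
    · rw [abs_sub_comm, h, abs_of_nonneg dist_nonneg, dist_comm]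
  · intro h
    rcases abs_choice (φ x - φ y) with h' | h'
    · left; linarith
    · right; rw [dist_comm]; linarith

theorem Gam_refl (x : X) : (x, x) ∈ Gam φ := by simp [mem_Gam]

theorem Rays_refl (x : X) : (x, x) ∈ Rays φ := by simp [mem_Rays]

theorem Rays_symm (h : (x, y) ∈ Rays φ) : (y, x) ∈ Rays φ := by
  rw [mem_Rays] at *; rw [dist_comm, h, abs_sub_comm]

theorem Rays_of_Gam (h : (x, y) ∈ Gam φ) : (x, y) ∈ Rays φ := Or.inl h

theorem Gam_of_Rays (h : (x, y) ∈ Rays φ) (h' : φ y ≤ φ x) : (x, y) ∈ Gam φ := by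
  rw [mem_Rays, abs_of_nonneg (by linarith)] at h
  exact h.symm

theorem le_of_Gam (h : (x, y) ∈ Gam φ) : φ y ≤ φ x := by
  rw [mem_Gam] at h; linarith [dist_nonneg (x := x) (y := y)]

theorem eq_of_Rays (h : (x, y) ∈ Rays φ) (h' : φ x = φ y) : x = y := by
  rw [mem_Rays] at h; simpa [h'] using h

theorem sub_le_dist (hφ : LipschitzWith 1 φ) (x y : X) : φ x - φ y ≤ dist x y := by
  have := hφ.dist_le_mul x y
  simp only [NNReal.coe_one, one_mul, Real.dist_eq] at this
  exact (le_abs_self _).trans this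

theorem Gam_trans (hφ : LipschitzWith 1 φ) (h : (x, y) ∈ Gam φ) (h' : (y, z) ∈ Gam φ) :
    (x, z) ∈ Gam φ := by
  rw [mem_Gam] at *
  have := sub_le_dist hφ x z
  have := dist_triangle x y z
  linarith

/-- Replacing `φ` by `-φ` reverses the rays, so each backward statement follows from its forward
version. -/
theorem mem_Gam_neg : (x, y) ∈ Gam (-φ) ↔ (y, x) ∈ Gam φ := by
  simp only [mem_Gam, Pi.neg_apply, dist_comm y x]
  constructor <;> intro h <;> linarith

theorem Rays_neg : Rays (-φ) = Rays φ := by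
  ext ⟨x, y⟩
  simp only [mem_Rays, Pi.neg_apply]
  rw [← abs_neg, neg_sub_neg, neg_sub]

theorem lipschitzWith_neg (hφ : LipschitzWith 1 φ) : LipschitzWith 1 (-φ) := by
  intro x y
  simpa [edist_neg_neg] using hφ x y

theorem mem_transportSetEnd : x ∈ transportSetEnd φ ↔ ∃ y, x ≠ y ∧ (x, y) ∈ Rays φ := by
  simp only [transportSetEnd, Rays, Set.mem_union, Set.mem_image, Set.mem_sdiff,
    Set.mem_diagonal_iff, Prod.exists, exists_and_right, exists_eq_right]
  constructor
  · rintro (⟨y, h, h'⟩ | ⟨y, h, h'⟩)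
    exacts [⟨y, h', Or.inl h⟩, ⟨y, h', Or.inr h⟩]
  · rintro ⟨y, h, h' | h'⟩
    exacts [Or.inl ⟨y, h', h⟩, Or.inr ⟨y, h', h⟩]

theorem transportSetEnd_neg : transportSetEnd (-φ) = transportSetEnd φ := by
  ext x; simp only [mem_transportSetEnd, Rays_neg]

theorem branchForward_neg : branchForward (-φ) = branchBackward φ := by
  ext x
  simp only [branchForward, branchBackward, transportSetEnd_neg, Rays_neg, mem_Gam_neg, GamInv,
    Set.mem_ofPred_eq]

theorem branchBackward_neg : branchBackward (-φ) = branchForward φ := by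
  rw [← branchForward_neg, neg_neg]

theorem transportSet_neg : transportSet (-φ) = transportSet φ := by
  rw [transportSet, transportSet, transportSetEnd_neg, branchForward_neg, branchBackward_neg,
    Set.union_comm]

theorem translation_neg (C : Set X) (t : ℝ) : translation (-φ) C t = translation φ C (-t) := by
  ext y
  simp only [translation, transportSet_neg, mem_Gam_neg, Set.mem_ofPred_eq, neg_neg,
    Left.nonneg_neg_iff, Left.neg_nonpos_iff]
  refine and_congr_right fun _ => exists_congr fun x => and_congr_right fun _ => ?_
  exact or_comm

theorem transportSet_subset : transportSet φ ⊆ transportSetEnd φ := Set.sdiff_subset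

/-- Points of the transport set do not branch: the rays through them form chains. -/
theorem Rays_trans (hφ : LipschitzWith 1 φ) (hy : y ∈ transportSet φ)
    (h : (x, y) ∈ Rays φ) (h' : (y, z) ∈ Rays φ) : (x, z) ∈ Rays φ := by
  obtain ⟨he, hb⟩ := hy
  rw [Set.mem_union, not_or] at hb
  -- In the mixed cases `x` and `z` lie on the same side of `y`, and failure of the claim would make
  -- `y` a branching point.
  rcases h with h | h <;> rcases h' with h' | h'
  · exact Or.inl (Gam_trans hφ h h')
  · by_contra hc
    exact hb.2 ⟨he, x, z, h, h', hc⟩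
  · by_contra hc
    exact hb.1 ⟨he, x, z, h, h', hc⟩
  · exact Or.inr (Gam_trans hφ h' h)

/-- The Lipschitz bounds on the two pieces add up to the total drop of `φ`, so both are equalities.
-/
theorem IsGeodesic.apply_eq (hφ : LipschitzWith 1 φ) {γ : unitInterval → X} (hγ : IsGeodesic γ)
    (h : (γ 0, γ 1) ∈ Gam φ) (s : unitInterval) :
    φ (γ s) = φ (γ 0) - s * dist (γ 0) (γ 1) := by
  have h0 := hγ 0 s
  have h1 := hγ s 1
  have e0 := sub_le_dist hφ (γ 0) (γ s)
  have e1 := sub_le_dist hφ (γ s) (γ 1)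
  rw [mem_Gam] at h
  have a0 : |((0 : unitInterval) : ℝ) - s| = s := by
    rw [abs_sub_comm]; simp [abs_of_nonneg s.2.1]
  have a1 : |(s : ℝ) - (1 : unitInterval)| = 1 - s := by
    rw [abs_sub_comm]; simp [abs_of_nonneg, s.2.2]
  rw [a0] at h0
  rw [a1] at h1
  rw [h0] at e0
  rw [h1] at e1
  linarith

theorem IsGeodesic.mem_Gam (hφ : LipschitzWith 1 φ) {γ : unitInterval → X} (hγ : IsGeodesic γ)
    (h : (γ 0, γ 1) ∈ Gam φ) {s t : unitInterval} (hst : s ≤ t) : (γ s, γ t) ∈ Gam φ := by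
  have hst' : (s : ℝ) ≤ t := hst
  rw [L1Transport.mem_Gam, hγ.apply_eq hφ h s, hγ.apply_eq hφ h t, hγ s t, abs_sub_comm,
    abs_of_nonneg (by linarith)]
  ring

theorem isGeodesic_of_mem_Gam {γ : unitInterval → X}
    (h : ∀ s t : unitInterval, s ≤ t → (γ s, γ t) ∈ Gam φ)
    (h' : ∀ s : unitInterval, φ (γ s) = φ (γ 0) - s * dist (γ 0) (γ 1)) : IsGeodesic γ := by
  have key : ∀ s t : unitInterval, s ≤ t →
      dist (γ s) (γ t) = |(s : ℝ) - t| * dist (γ 0) (γ 1) := by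
    intro s t hst
    have hst' : (s : ℝ) ≤ t := hst
    rw [← (h s t hst : _ = _)]
    simp only
    rw [h' s, h' t, abs_sub_comm, abs_of_nonneg (by linarith)]
    ring
  intro s t
  rcases le_total s t with hst | hst
  · exact key s t hst
  · rw [dist_comm, abs_sub_comm, key t s hst]

/-- Parametrizing by the value of `φ` instead of time makes concatenation a mere case split on the
level. -/
theorem exists_segment (hgeo : GeodesicSpace X) (hφ : LipschitzWith 1 φ)
    (h : (x, y) ∈ Gam φ) :
    ∃ σ : ℝ → X, σ (φ x) = x ∧ σ (φ y) = y ∧ (∀ r ∈ Set.Icc (φ y) (φ x), φ (σ r) = r) ∧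
      ∀ r ∈ Set.Icc (φ y) (φ x), ∀ r' ∈ Set.Icc (φ y) (φ x), r ≤ r' → (σ r', σ r) ∈ Gam φ := by
  rcases eq_or_ne x y with rfl | hxy
  · refine ⟨fun _ => x, rfl, rfl, fun r hr => ?_, fun _ _ _ _ _ => Gam_refl x⟩
    rw [Set.Icc_self] at hr
    exact hr.symm
  obtain ⟨γ, hγ, h0, h1⟩ := hgeo x y
  have hpos : 0 < dist x y := dist_pos.2 hxy
  have e := mem_Gam.1 h
  have hG : (γ 0, γ 1) ∈ Gam φ := by rw [h0, h1]; exact h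
  refine ⟨fun r => γ (Set.projIcc 0 1 zero_le_one ((φ x - r) / dist x y)), ?_, ?_, ?_, ?_⟩
  · simp [h0]
  · simp [e, hpos.ne', h1]
  · intro r hr
    have hm : (φ x - r) / dist x y ∈ Set.Icc (0 : ℝ) 1 := by
      constructor
      · apply div_nonneg <;> linarith [hr.2]
      · rw [div_le_one hpos]; linarith [hr.1]
    rw [hγ.apply_eq hφ hG, Set.projIcc_of_mem _ hm, h0, h1]
    field_simp
    ring
  · intro r _ r' _ hrr
    refine hγ.mem_Gam hφ hG (Set.monotone_projIcc _ ?_)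
    gcongr

theorem exists_mem_Gam_apply_eq (hgeo : GeodesicSpace X) (hφ : LipschitzWith 1 φ)
    (h : (x, y) ∈ Gam φ) {r : ℝ} (hr : φ y ≤ r) (hr' : r ≤ φ x) :
    ∃ z, (x, z) ∈ Gam φ ∧ (z, y) ∈ Gam φ ∧ φ z = r := by
  obtain ⟨σ, hx, hy, h1, h2⟩ := exists_segment hgeo hφ h
  have hm := Set.left_mem_Icc.2 (hr.trans hr')
  have hm' := Set.right_mem_Icc.2 (hr.trans hr')
  refine ⟨σ r, ?_, ?_, h1 r ⟨hr, hr'⟩⟩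
  · simpa only [hx] using h2 r ⟨hr, hr'⟩ _ hm' hr'
  · simpa only [hy] using h2 _ hm r ⟨hr, hr'⟩ hr

theorem exists_Rays_apply_eq (hgeo : GeodesicSpace X) (hφ : LipschitzWith 1 φ)
    (h : (x, y) ∈ Rays φ) {r : ℝ} (hr : r ∈ Set.uIcc (φ x) (φ y)) :
    ∃ z, (x, z) ∈ Rays φ ∧ (z, y) ∈ Rays φ ∧ φ z = r := by
  rcases h with h | h
  · rw [Set.uIcc_of_ge (le_of_Gam h)] at hr
    obtain ⟨z, h1, h2, h3⟩ := exists_mem_Gam_apply_eq hgeo hφ h hr.1 hr.2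
    exact ⟨z, Or.inl h1, Or.inl h2, h3⟩
  · rw [Set.uIcc_of_le (le_of_Gam h)] at hr
    obtain ⟨z, h1, h2, h3⟩ := exists_mem_Gam_apply_eq hgeo hφ h hr.1 hr.2
    exact ⟨z, Or.inr h2, Or.inr h1, h3⟩

/-- Concatenation of two geodesics along a ray. -/
theorem exists_isGeodesic_through (hgeo : GeodesicSpace X) (hφ : LipschitzWith 1 φ)
    (h : (x, y) ∈ Gam φ) (h' : (y, z) ∈ Gam φ)
    {t : unitInterval} (ht : (t : ℝ) * dist x z = dist x y) :
    ∃ γ : unitInterval → X, IsGeodesic γ ∧ γ 0 = x ∧ γ t = y ∧ γ 1 = z := by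
  have e1 := mem_Gam.1 h
  have e2 := mem_Gam.1 h'
  have e3 := mem_Gam.1 (Gam_trans hφ h h')
  have l1 := le_of_Gam h
  have l2 := le_of_Gam h'
  obtain ⟨σ₁, hx₁, hy₁, hl₁, hm₁⟩ := exists_segment hgeo hφ h
  obtain ⟨σ₂, hx₂, hy₂, hl₂, hm₂⟩ := exists_segment hgeo hφ h'
  obtain ⟨σ, hσ⟩ : ∃ σ : ℝ → X, σ = fun r => if r ≤ φ y then σ₂ r else σ₁ r := ⟨_, rfl⟩
  have s2 : ∀ r, r ≤ φ y → σ r = σ₂ r := fun r hr => by rw [hσ]; exact if_pos hr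
  have s1 : ∀ r, φ y ≤ r → σ r = σ₁ r := fun r hr => by
    rcases hr.eq_or_lt with rfl | hr
    · rw [s2 _ le_rfl, hx₂, hy₁]
    · rw [hσ]; exact if_neg hr.not_ge
  have hlev : ∀ r, φ z ≤ r → r ≤ φ x → φ (σ r) = r := fun r hr hr' => by
    rcases le_total r (φ y) with hc | hc
    · rw [s2 r hc, hl₂ r ⟨hr, hc⟩]
    · rw [s1 r hc, hl₁ r ⟨hc, hr'⟩]
  have hmon : ∀ r r', φ z ≤ r → r ≤ r' → r' ≤ φ x → (σ r', σ r) ∈ Gam φ := by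
    intro r r' h1 h2 h3
    have hyl : φ y ∈ Set.Icc (φ y) (φ x) := ⟨le_rfl, l1⟩
    have hyr : φ y ∈ Set.Icc (φ z) (φ y) := ⟨l2, le_rfl⟩
    rcases le_total r' (φ y) with hc | hc
    · rw [s2 r' hc, s2 r (h2.trans hc)]
      exact hm₂ r ⟨h1, h2.trans hc⟩ r' ⟨h1.trans h2, hc⟩ h2
    · rcases le_total r (φ y) with hd | hd
      · refine Gam_trans hφ (y := σ (φ y)) ?_ ?_
        · rw [s1 r' hc, s1 _ le_rfl]
          exact hm₁ _ hyl r' ⟨hc, h3⟩ hc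
        · rw [s2 r hd, s2 _ le_rfl]
          exact hm₂ r ⟨h1, hd⟩ _ hyr hd
      · rw [s1 r' hc, s1 r hd]
        exact hm₁ r ⟨hd, h2.trans h3⟩ r' ⟨hc, h3⟩ h2
  have hb : ∀ s : unitInterval, φ z ≤ φ x - s * dist x z ∧ φ x - s * dist x z ≤ φ x := fun s => by
    have : (s : ℝ) * dist x z ≤ 1 * dist x z := mul_le_mul_of_nonneg_right s.2.2 dist_nonneg
    have : 0 ≤ (s : ℝ) * dist x z := mul_nonneg s.2.1 dist_nonneg
    constructor <;> linarith
  have g0 : σ (φ x - ((0 : unitInterval) : ℝ) * dist x z) = x := by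
    simp [s1 _ l1, hx₁]
  have g1 : σ (φ x - ((1 : unitInterval) : ℝ) * dist x z) = z := by
    rw [← e3]; simp [s2 _ l2, hy₂]
  refine ⟨fun s => σ (φ x - s * dist x z), ?_, g0, ?_, g1⟩
  · refine isGeodesic_of_mem_Gam (φ := φ) (fun s t hst => ?_) (fun s => ?_)
    · refine hmon _ _ (hb t).1 ?_ (hb s).2
      have : (s : ℝ) * dist x z ≤ t * dist x z := mul_le_mul_of_nonneg_right hst dist_nonneg
      linarith
    · simp only [g0, g1]
      exact hlev _ (hb s).1 (hb s).2
  · have : φ x - (t : ℝ) * dist x z = φ y := by rw [ht]; linarith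
    simp only [this, s1 _ le_rfl, hy₁]

/-- In a non-branching space, rays can only branch at their end points. -/
theorem Rays_of_Gam_of_ne (hgeo : GeodesicSpace X) (hnb : NonBranching X) (hφ : LipschitzWith 1 φ)
    (hxy : x ≠ y) (h : (x, y) ∈ Gam φ) (hz : (y, z) ∈ Gam φ) (hw : (y, w) ∈ Gam φ) :
    (z, w) ∈ Rays φ := by
  wlog hle : φ w ≤ φ z generalizing z w
  · exact Rays_symm (this hw hz (le_of_not_ge hle))
  -- Cut the longer branch at the level of `z`. The geodesics from `x` through `y` to `z` and to
  -- `w'` then have equal length and meet at the same time `t`, so `z = w'`.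
  obtain ⟨w', h1, h2, h3⟩ := exists_mem_Gam_apply_eq hgeo hφ hw hle (le_of_Gam hz)
  rcases eq_or_ne y z with rfl | hyz
  · exact Rays_of_Gam hw
  have hyw' : y ≠ w' := by
    rintro rfl
    exact hyz (eq_of_Rays (Rays_of_Gam hz) h3)
  have d1 := mem_Gam.1 (Gam_trans hφ h hz)
  have d2 := mem_Gam.1 (Gam_trans hφ h h1)
  have e1 := mem_Gam.1 h
  have e2 := mem_Gam.1 hz
  have p1 : 0 < dist x y := dist_pos.2 hxy
  have p2 : 0 < dist y z := dist_pos.2 hyz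
  have p3 : 0 < dist x z := by linarith
  have hdd : dist x w' = dist x z := by linarith
  let t : unitInterval := ⟨dist x y / dist x z, by positivity, by
    rw [div_le_one p3]; linarith⟩
  have ht : (t : ℝ) * dist x z = dist x y := by simp only [t]; field_simp
  obtain ⟨γ₁, g1, a1, b1, c1⟩ := exists_isGeodesic_through hgeo hφ h hz ht
  obtain ⟨γ₂, g2, a2, b2, c2⟩ := exists_isGeodesic_through hgeo hφ h h1 (hdd ▸ ht)
  have := hnb γ₁ γ₂ g1 g2 (a1.trans a2.symm) ⟨t, ?_, ?_, b1.trans b2.symm⟩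
  · rw [← c1, this, c2]
    exact Rays_of_Gam h2
  · rw [← Subtype.coe_lt_coe]
    simp only [t, Set.Icc.coe_zero]
    positivity
  · rw [← Subtype.coe_lt_coe]
    simp only [t, Set.Icc.coe_one]
    rw [div_lt_one p3]; linarith

/-- A distinct point upstream would make the branching point interior, where non-branching forbids
it. -/
theorem eq_of_mem_branchForward (hgeo : GeodesicSpace X) (hnb : NonBranching X)
    (hφ : LipschitzWith 1 φ) (hy : y ∈ branchForward φ) (h : (x, y) ∈ Gam φ) : x = y := by
  by_contra hxy
  obtain ⟨-, z, w, hz, hw, hc⟩ := hy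
  exact hc (Rays_of_Gam_of_ne hgeo hnb hφ hxy h hz hw)

theorem eq_of_mem_branchBackward (hgeo : GeodesicSpace X) (hnb : NonBranching X)
    (hφ : LipschitzWith 1 φ) (hy : y ∈ branchBackward φ) (h : (y, x) ∈ Gam φ) : x = y := by
  rw [← branchForward_neg] at hy
  exact eq_of_mem_branchForward hgeo hnb (lipschitzWith_neg hφ) hy (mem_Gam_neg.2 h)

/-- An interior point of a ray belongs to the transport set. -/
theorem mem_transportSet_of_Gam (hgeo : GeodesicSpace X) (hnb : NonBranching X)
    (hφ : LipschitzWith 1 φ) (h : (x, y) ∈ Gam φ) (h' : (y, z) ∈ Gam φ) (hxy : x ≠ y)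
    (hyz : y ≠ z) : y ∈ transportSet φ := by
  refine ⟨mem_transportSetEnd.2 ⟨z, hyz, Or.inl h'⟩, ?_⟩
  rintro (hb | hb)
  · exact hxy (eq_of_mem_branchForward hgeo hnb hφ hb h)
  · exact hyz (eq_of_mem_branchBackward hgeo hnb hφ hb h').symm

end Geometry

end L1Transport

/-! ### Borel measurability and null sets under (A.1). -/

namespace L1Transport

/-- An open set is a countable union of closed sets. Since σ-compactness survives continuous images,
the projections below are Borel and not merely analytic. -/
theorem isSigmaCompact_inter {Y : Type*} [MetricSpace Y] [ProperSpace Y] {F U : Set Y}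
    (hF : IsClosed F) (hU : IsOpen U) : IsSigmaCompact (F ∩ U) := by
  obtain ⟨G, hG, -, hGU, -⟩ := hU.exists_iUnion_isClosed
  rw [← hGU, Set.inter_iUnion]
  refine isSigmaCompact_iUnion _ fun n => ?_
  exact isSigmaCompact_univ.of_isClosed_subset (hF.inter (hG n)) (Set.subset_univ _)

theorem measurableSet_of_isSigmaCompact {Y : Type*} [TopologicalSpace Y] [T2Space Y]
    [MeasurableSpace Y] [OpensMeasurableSpace Y] {S : Set Y} (hS : IsSigmaCompact S) :
    MeasurableSet S := by
  obtain ⟨K, hK, rfl⟩ := hS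
  exact MeasurableSet.iUnion fun n => (hK n).measurableSet

/-- Projections of differences of closed sets in proper spaces are Borel. -/
theorem measurableSet_image_inter {Y Z : Type*} [MetricSpace Y] [ProperSpace Y]
    [TopologicalSpace Z] [T2Space Z] [MeasurableSpace Z] [OpensMeasurableSpace Z] {F U : Set Y}
    (hF : IsClosed F) (hU : IsOpen U) {f : Y → Z} (hf : Continuous f) :
    MeasurableSet (f '' (F ∩ U)) :=
  measurableSet_of_isSigmaCompact ((isSigmaCompact_inter hF hU).image hf)

section Borel

theorem AssumptionA1.neg {X : Type*} [MetricSpace X] [MeasurableSpace X] {φ : X → ℝ} {m : Measure X} (hA1 : AssumptionA1 m φ) : AssumptionA1 m (-φ) := by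
  intro C hC hCe hm hc
  rw [transportSetEnd_neg] at hCe
  refine hA1 C hC hCe hm ?_
  refine (hc.image Neg.neg).mono fun t ht => (Set.mem_image _ _ _).2 ⟨-t, ?_, neg_neg t⟩
  simpa only [Set.mem_ofPred_eq, translation_neg, neg_neg] using ht

variable {X : Type*} [MetricSpace X] {φ : X → ℝ}

theorem isClosed_Gam (hφ : Continuous φ) : IsClosed (Gam φ) :=
  isClosed_eq (by fun_prop) (by fun_prop)

theorem isClosed_Rays (hφ : Continuous φ) : IsClosed (Rays φ) :=
  (isClosed_Gam hφ).union ((isClosed_Gam hφ).preimage continuous_swap)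

variable [ProperSpace X] [MeasurableSpace X] [BorelSpace X]

theorem measurableSet_transportSetEnd (hφ : Continuous φ) :
    MeasurableSet (transportSetEnd φ) := by
  have : transportSetEnd φ = Prod.fst '' (Rays φ ∩ {p : X × X | p.1 ≠ p.2}) := by
    ext x
    simp only [mem_transportSetEnd, Set.mem_image, Set.mem_inter_iff, Set.mem_ofPred_eq,
      Prod.exists, exists_and_right, exists_eq_right]
    exact exists_congr fun y => and_comm
  rw [this]
  exact measurableSet_image_inter (isClosed_Rays hφ)
    (isOpen_ne_fun continuous_fst continuous_snd) continuous_fst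

theorem measurableSet_branchForward (hφ : Continuous φ) :
    MeasurableSet (branchForward φ) := by
  have : branchForward φ = transportSetEnd φ ∩ Prod.fst ''
      ({p : X × X × X | (p.1, p.2.1) ∈ Gam φ ∧ (p.1, p.2.2) ∈ Gam φ} ∩
        {p : X × X × X | p.2 ∈ (Rays φ)ᶜ}) := by
    ext x
    refine and_congr_right fun _ => ⟨?_, ?_⟩
    · rintro ⟨z, w, h1, h2, h3⟩
      exact ⟨(x, z, w), ⟨⟨h1, h2⟩, h3⟩, rfl⟩
    · rintro ⟨⟨x, z, w⟩, ⟨⟨h1, h2⟩, h3⟩, rfl⟩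
      exact ⟨z, w, h1, h2, h3⟩
  rw [this]
  refine (measurableSet_transportSetEnd hφ).inter
    (measurableSet_image_inter (IsClosed.inter ?_ ?_) ?_ continuous_fst)
  · exact (isClosed_Gam hφ).preimage (f := fun p : X × X × X => (p.1, p.2.1)) (by fun_prop)
  · exact (isClosed_Gam hφ).preimage (f := fun p : X × X × X => (p.1, p.2.2)) (by fun_prop)
  · exact (isClosed_Rays hφ).isOpen_compl.preimage continuous_snd

theorem measurableSet_branchBackward (hφ : Continuous φ) :
    MeasurableSet (branchBackward φ) := by
  rw [← branchForward_neg]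
  exact measurableSet_branchForward hφ.neg

theorem measurableSet_transportSet (hφ : Continuous φ) : MeasurableSet (transportSet φ) :=
  (measurableSet_transportSetEnd hφ).diff
    ((measurableSet_branchForward hφ).union (measurableSet_branchBackward hφ))

theorem measurableSet_translation (hφ : Continuous φ) {C : Set X} (hC : IsClosed C) (t : ℝ) :
    MeasurableSet (translation φ C t) := by
  have : translation φ C t = transportSet φ ∩ Prod.snd ''
      ({p : X × X | p.1 ∈ C ∧ ((0 ≤ t ∧ (p.1, p.2) ∈ Gam φ ∧ dist p.1 p.2 = t) ∨
        (t ≤ 0 ∧ (p.2, p.1) ∈ Gam φ ∧ dist p.1 p.2 = -t))} ∩ Set.univ) := by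
    ext y
    simp [translation]
  rw [this]
  refine (measurableSet_transportSet hφ).inter
    (measurableSet_image_inter (IsClosed.inter ?_ (IsClosed.union ?_ ?_)) isOpen_univ
      continuous_snd)
  · exact hC.preimage continuous_fst
  · exact isClosed_const.inter (IsClosed.inter (isClosed_Gam hφ)
      (isClosed_eq continuous_dist continuous_const))
  · exact isClosed_const.inter (IsClosed.inter ((isClosed_Gam hφ).preimage continuous_swap)
      (isClosed_eq continuous_dist continuous_const))

/-- Under (A.1), a Borel set that meets each ray in at most one point is negligible. -/
theorem measure_eq_zero_of_subsingleton_rays {m : Measure X} [IsFiniteMeasure m]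
    (hφ : Continuous φ) (hA1 : AssumptionA1 m φ) {A : Set X} (hA : MeasurableSet A)
    (hAe : A ⊆ transportSetEnd φ)
    (h : ∀ x ∈ A, ∀ x' ∈ A, ∀ y ∈ transportSet φ, (x, y) ∈ Rays φ → (x', y) ∈ Rays φ → x = x') :
    m A = 0 := by
  by_contra hne
  obtain ⟨C, hCA, hC, hmC⟩ := hA.exists_lt_isCompact_of_ne_top (measure_ne_top m A)
    (pos_iff_ne_zero.2 hne)
  refine hA1 C hC (hCA.trans hAe) hmC ?_
  -- Disjoint translations suffice, as `m` is finite.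
  refine Measure.countable_meas_pos_of_disjoint_iUnion
    (fun t => measurableSet_translation hφ hC.isClosed t) ?_
  intro s t hst
  refine Set.disjoint_left.2 ?_
  -- The translation time is the drop of `φ`, so it is determined by the two points.
  have key : ∀ (r : ℝ) (x y : X), ((0 ≤ r ∧ (x, y) ∈ Gam φ ∧ dist x y = r) ∨
      (r ≤ 0 ∧ (y, x) ∈ Gam φ ∧ dist x y = -r)) → (x, y) ∈ Rays φ ∧ φ x - φ y = r := by
    rintro r x y (⟨-, h1, h2⟩ | ⟨-, h1, h2⟩)
    · exact ⟨Or.inl h1, by rw [← h2]; exact h1⟩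
    · refine ⟨Or.inr h1, ?_⟩
      rw [mem_Gam, dist_comm] at h1
      linarith
  rintro y ⟨hy, x, hx, h1⟩ ⟨-, x', hx', h2⟩
  obtain ⟨r1, e1⟩ := key s x y h1
  obtain ⟨r2, e2⟩ := key t x' y h2
  have := h x (hCA hx) x' (hCA hx') y hy r1 r2
  rw [this] at e1
  exact hst (e1.symm.trans e2)

/-- Of two points of `A₊` on a common ray, one precedes the other, so they coincide. -/
theorem measure_branchForward {m : Measure X} [IsFiniteMeasure m] (hgeo : GeodesicSpace X)
    (hnb : NonBranching X) (hφ : LipschitzWith 1 φ) (hA1 : AssumptionA1 m φ) :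
    m (branchForward φ) = 0 := by
  refine measure_eq_zero_of_subsingleton_rays hφ.continuous hA1
    (measurableSet_branchForward hφ.continuous) (fun x hx => hx.1) ?_
  intro x hx x' hx' y hy h h'
  rcases Rays_trans hφ hy h (Rays_symm h') with hr | hr
  · exact eq_of_mem_branchForward hgeo hnb hφ hx' hr
  · exact (eq_of_mem_branchForward hgeo hnb hφ hx hr).symm

theorem measure_branchBackward {m : Measure X} [IsFiniteMeasure m] (hgeo : GeodesicSpace X)
    (hnb : NonBranching X) (hφ : LipschitzWith 1 φ) (hA1 : AssumptionA1 m φ) :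
    m (branchBackward φ) = 0 := by
  rw [← branchForward_neg]
  exact measure_branchForward hgeo hnb (lipschitzWith_neg hφ) hA1.neg

end Borel

/-! ### Levels of `φ` as coordinates on the rays, and a Borel cross-section. -/

section Levels

variable {X : Type*} [MetricSpace X] {φ : X → ℝ} {x y x' : X} {r : ℝ}

/-- The pairs of a point and a level of `φ` attained on a ray through this point. -/
def rayLevels (φ : X → ℝ) : Set (X × ℝ) := {p | ∃ y, (p.1, y) ∈ Rays φ ∧ φ y = p.2}

theorem mem_rayLevels : (x, r) ∈ rayLevels φ ↔ ∃ y, (x, y) ∈ Rays φ ∧ φ y = r := Iff.rfl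

open scoped Classical in
/-- The point at level `r` of the ray through a point of the transport set. -/
noncomputable def rayPoint (φ : X → ℝ) (p : X × ℝ) : X :=
  if h : p.1 ∈ transportSet φ ∧ p ∈ rayLevels φ then h.2.choose else p.1

/-- `φ` is injective on the ray of a point of `𝒯`, so the choice in `rayPoint` is forced. -/
theorem rayPoint_eq (hφ : LipschitzWith 1 φ) (hx : x ∈ transportSet φ) (h : (x, y) ∈ Rays φ) :
    rayPoint φ (x, φ y) = y := by
  have hc : (x, φ y).1 ∈ transportSet φ ∧ (x, φ y) ∈ rayLevels φ := ⟨hx, y, h, rfl⟩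
  have hs := hc.2.choose_spec
  rw [rayPoint, dif_pos hc]
  exact eq_of_Rays (Rays_trans hφ hx (Rays_symm hs.1) h) hs.2

theorem rayPoint_eq' (hφ : LipschitzWith 1 φ) (hx : x ∈ transportSet φ) (h : (x, y) ∈ Rays φ)
    (hr : φ y = r) : rayPoint φ (x, r) = y :=
  hr ▸ rayPoint_eq hφ hx h

theorem rayPoint_spec (hφ : LipschitzWith 1 φ) (hx : x ∈ transportSet φ)
    (h : (x, r) ∈ rayLevels φ) : (x, rayPoint φ (x, r)) ∈ Rays φ ∧ φ (rayPoint φ (x, r)) = r := by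
  obtain ⟨y, h1, rfl⟩ := mem_rayLevels.1 h
  rw [rayPoint_eq hφ hx h1]
  exact ⟨h1, rfl⟩

theorem rayLevels_congr (hφ : LipschitzWith 1 φ) (hx : x ∈ transportSet φ)
    (hx' : x' ∈ transportSet φ) (h : (x, x') ∈ Rays φ) :
    (x, r) ∈ rayLevels φ ↔ (x', r) ∈ rayLevels φ := by
  constructor
  · rintro ⟨y, h1, h2⟩
    exact ⟨y, Rays_trans hφ hx (Rays_symm h) h1, h2⟩
  · rintro ⟨y, h1, h2⟩
    exact ⟨y, Rays_trans hφ hx' h h1, h2⟩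

theorem rayPoint_congr (hφ : LipschitzWith 1 φ) (hx : x ∈ transportSet φ)
    (hx' : x' ∈ transportSet φ) (h : (x, x') ∈ Rays φ) (hr : (x, r) ∈ rayLevels φ) :
    rayPoint φ (x, r) = rayPoint φ (x', r) := by
  obtain ⟨y, h1, rfl⟩ := mem_rayLevels.1 hr
  rw [rayPoint_eq hφ hx h1, rayPoint_eq hφ hx' (Rays_trans hφ hx (Rays_symm h) h1)]

/-- `p.2.1` is an interior level of the ray of `x`, between the levels `p.1` and `p.2.2`. -/
def IsInteriorLevel (φ : X → ℝ) (x : X) (p : ℝ × ℝ × ℝ) : Prop :=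
  (p.1 < p.2.1 ∧ p.2.1 < p.2.2) ∧ (x, p.1) ∈ rayLevels φ ∧ (x, p.2.2) ∈ rayLevels φ

/-- Either the level is that of `x`, or the point at this level lies strictly between two points of
the ray. The strict inequalities keep the cross-section inside `𝒯`. -/
theorem IsInteriorLevel.exists_mem (hgeo : GeodesicSpace X) (hnb : NonBranching X)
    (hφ : LipschitzWith 1 φ) (hx : x ∈ transportSet φ) {p : ℝ × ℝ × ℝ}
    (h : IsInteriorLevel φ x p) :
    ∃ y ∈ transportSet φ, (x, y) ∈ Rays φ ∧ φ y = p.2.1 := by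
  obtain ⟨⟨h1, h2⟩, ⟨u, hu, hu'⟩, ⟨v, hv, hv'⟩⟩ := h
  simp only at hu hu' hv hv'
  rcases lt_trichotomy (φ x) p.2.1 with hc | hc | hc
  · obtain ⟨y, a, b, c⟩ := exists_Rays_apply_eq hgeo hφ hv (r := p.2.1)
      (by rw [Set.uIcc_of_le (by linarith)]; constructor <;> linarith)
    refine ⟨y, ?_, a, c⟩
    refine mem_transportSet_of_Gam hgeo hnb hφ (x := v) (z := x)
      (Gam_of_Rays (Rays_symm b) (by linarith)) (Gam_of_Rays (Rays_symm a) (by linarith)) ?_ ?_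
    · rintro rfl; linarith
    · rintro rfl; linarith
  · exact ⟨x, hx, Rays_refl x, hc⟩
  · obtain ⟨y, a, b, c⟩ := exists_Rays_apply_eq hgeo hφ hu (r := p.2.1)
      (by rw [Set.uIcc_of_ge (by linarith)]; constructor <;> linarith)
    refine ⟨y, ?_, a, c⟩
    refine mem_transportSet_of_Gam hgeo hnb hφ (x := x) (z := u)
      (Gam_of_Rays a (by linarith)) (Gam_of_Rays b (by linarith)) ?_ ?_
    · rintro rfl; linarith
    · rintro rfl; linarith

theorem exists_isInteriorLevel (hgeo : GeodesicSpace X) (hφ : LipschitzWith 1 φ)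
    (hx : x ∈ transportSetEnd φ) :
    ∃ a b c : ℚ, IsInteriorLevel φ x (a, b, c) := by
  obtain ⟨u, hne, hu⟩ := mem_transportSetEnd.1 hx
  have hlt : min (φ x) (φ u) < max (φ x) (φ u) :=
    min_lt_max.2 fun h => hne (eq_of_Rays hu h)
  obtain ⟨b, h1, h2⟩ := exists_rat_btwn hlt
  obtain ⟨a, h3, h4⟩ := exists_rat_btwn h1
  obtain ⟨c, h5, h6⟩ := exists_rat_btwn h2
  refine ⟨a, b, c, ⟨h4, h5⟩, ?_, ?_⟩
  · obtain ⟨y, h, -, h'⟩ := exists_Rays_apply_eq hgeo hφ hu (r := a)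
      ⟨h3.le, (h4.trans h2).le⟩
    exact ⟨y, h, h'⟩
  · obtain ⟨y, h, -, h'⟩ := exists_Rays_apply_eq hgeo hφ hu (r := c)
      ⟨(h1.trans h5).le, h6.le⟩
    exact ⟨y, h, h'⟩

theorem isInteriorLevel_congr (hφ : LipschitzWith 1 φ) (hx : x ∈ transportSet φ)
    (hx' : x' ∈ transportSet φ) (h : (x, x') ∈ Rays φ) (p : ℝ × ℝ × ℝ) :
    IsInteriorLevel φ x p ↔ IsInteriorLevel φ x' p := by
  rw [IsInteriorLevel, IsInteriorLevel, rayLevels_congr hφ hx hx' h, rayLevels_congr hφ hx hx' h]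

variable [ProperSpace X] [MeasurableSpace X] [BorelSpace X]

theorem measurableSet_rayLevels_of_isClosed (hφ : Continuous φ) {F : Set X} (hF : IsClosed F) :
    MeasurableSet {p : X × ℝ | ∃ y ∈ F, (p.1, y) ∈ Rays φ ∧ φ y = p.2} := by
  have : {p : X × ℝ | ∃ y ∈ F, (p.1, y) ∈ Rays φ ∧ φ y = p.2} =
      (fun p : X × X => (p.1, φ p.2)) '' ((Rays φ ∩ Prod.snd ⁻¹' F) ∩ Set.univ) := by
    ext ⟨x, r⟩
    simp only [Set.mem_ofPred_eq, Set.inter_univ, Set.mem_image, Set.mem_inter_iff,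
      Set.mem_preimage, Prod.mk.injEq, Prod.exists]
    constructor
    · rintro ⟨y, h1, h2, h3⟩
      exact ⟨x, y, ⟨h2, h1⟩, rfl, h3⟩
    · rintro ⟨_, y, ⟨h2, h1⟩, rfl, h3⟩
      exact ⟨y, h1, h2, h3⟩
  rw [this]
  exact measurableSet_image_inter ((isClosed_Rays hφ).inter (hF.preimage continuous_snd))
    isOpen_univ (by fun_prop)

theorem measurableSet_rayLevels (hφ : Continuous φ) : MeasurableSet (rayLevels φ) := by
  simpa [rayLevels] using measurableSet_rayLevels_of_isClosed hφ isClosed_univ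

theorem measurable_rayPoint (hφ : LipschitzWith 1 φ) : Measurable (rayPoint φ) := by
  refine measurable_of_isClosed fun F hF => ?_
  have hD : MeasurableSet {p : X × ℝ | p.1 ∈ transportSet φ ∧ p ∈ rayLevels φ} :=
    (measurable_fst (measurableSet_transportSet hφ.continuous)).inter
      (measurableSet_rayLevels hφ.continuous)
  -- By uniqueness, `rayPoint` lies in `F` exactly when some point of `F` on the ray has this level,
  -- which is a Borel condition.
  have : rayPoint φ ⁻¹' F =
      ({p : X × ℝ | p.1 ∈ transportSet φ ∧ p ∈ rayLevels φ} ∩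
        {p : X × ℝ | ∃ y ∈ F, (p.1, y) ∈ Rays φ ∧ φ y = p.2}) ∪
      ({p : X × ℝ | p.1 ∈ transportSet φ ∧ p ∈ rayLevels φ}ᶜ ∩ Prod.fst ⁻¹' F) := by
    ext ⟨x, r⟩
    by_cases hc : x ∈ transportSet φ ∧ (x, r) ∈ rayLevels φ
    · simp only [Set.mem_preimage, Set.mem_union, Set.mem_inter_iff, Set.mem_ofPred_eq, hc,
        Set.mem_compl_iff, not_true, false_and, or_false, true_and, and_self]
      have hs := rayPoint_spec hφ hc.1 hc.2
      constructor
      · exact fun h => ⟨_, h, hs⟩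
      · rintro ⟨y, h, h1, h2⟩
        rwa [rayPoint_eq' hφ hc.1 h1 h2]
    · have : rayPoint φ (x, r) = x := dif_neg hc
      simp only [Set.mem_preimage, Set.mem_union, Set.mem_inter_iff, Set.mem_ofPred_eq, hc,
        Set.mem_compl_iff, not_false_eq_true, false_and, false_or, true_and, this]
  rw [this]
  exact (hD.inter (measurableSet_rayLevels_of_isClosed hφ.continuous hF)).union
    (hD.compl.inter (measurable_fst hF.measurableSet))

/-- A Borel cross-section of the rays. -/
theorem exists_rayBase (hgeo : GeodesicSpace X) (hnb : NonBranching X)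
    (hφ : LipschitzWith 1 φ) :
    ∃ Q : X → X, Measurable Q ∧ (∀ x ∈ transportSet φ, Q x ∈ transportSet φ ∧ (x, Q x) ∈ Rays φ) ∧
      ∀ x ∈ transportSet φ, ∀ x' ∈ transportSet φ, (x, x') ∈ Rays φ → Q x = Q x' := by
  classical
  obtain ⟨e, he⟩ := exists_surjective_nat (ℚ × ℚ × ℚ)
  let q : ℕ → ℝ × ℝ × ℝ := fun n => ((e n).1, (e n).2.1, (e n).2.2)
  -- The first rational triple that fits depends only on the ray, so its middle level selects one
  -- point per ray. Off `𝒯` the condition is vacuous, which makes `Nat.find` total.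
  let P : ℕ → X → Prop := fun n x => x ∈ transportSet φ → IsInteriorLevel φ x (q n)
  have hP : ∀ x, ∃ n, P n x := fun x => by
    by_cases hx : x ∈ transportSet φ
    · obtain ⟨a, b, c, h⟩ := exists_isInteriorLevel hgeo hφ (transportSet_subset hx)
      obtain ⟨n, hn⟩ := he (a, b, c)
      refine ⟨n, fun _ => ?_⟩
      simpa only [q, hn] using h
    · exact ⟨0, fun h => absurd h hx⟩
  have hPm : ∀ n, MeasurableSet {x | P n x} := fun n => by
    have h1 : ∀ r, MeasurableSet {x : X | (x, r) ∈ rayLevels φ} := fun r =>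
      (measurableSet_rayLevels hφ.continuous).preimage (measurable_id.prodMk measurable_const)
    exact (measurableSet_transportSet hφ.continuous).imp
      ((MeasurableSet.const _).inter ((h1 _).inter (h1 _)))
  refine ⟨fun x => rayPoint φ (x, (q (Nat.find (hP x))).2.1), ?_, ?_, ?_⟩
  · exact Measurable.find (f := fun n x => rayPoint φ (x, (q n).2.1))
      (fun n => (measurable_rayPoint hφ).comp (measurable_id.prodMk measurable_const)) hPm hP
  · intro x hx
    obtain ⟨y, h1, h2, h3⟩ := (Nat.find_spec (hP x) hx).exists_mem hgeo hnb hφ hx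
    simp only [rayPoint_eq' hφ hx h2 h3]
    exact ⟨h1, h2⟩
  · intro x hx x' hx' h
    have hPP : ∀ n, P n x ↔ P n x' := fun n => by
      simp only [P, hx, hx', true_imp_iff, isInteriorLevel_congr hφ hx hx' h]
    have hfind : Nat.find (hP x) = Nat.find (hP x') := Nat.find_congr' (hPP _)
    obtain ⟨y, -, h2, h3⟩ := (Nat.find_spec (hP x) hx).exists_mem hgeo hnb hφ hx
    simp only [← hfind]
    exact rayPoint_congr hφ hx hx' h ⟨y, h2, h3⟩

end Levels

end L1Transport

namespace L1Transport

/-! ### Quantiles and monotone rearrangement on the line. -/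

section Quantile

open ProbabilityTheory Filter Topology

open scoped Classical in
/-- The quantile function of a probability measure on the real line, set to `0` outside `(0,1)`. -/
noncomputable def quantile (μ : Measure ℝ) (c : ℝ) : ℝ :=
  if 0 < c ∧ c < 1 then sInf {t | c ≤ cdf μ t} else 0

variable {μ ν : Measure ℝ} {c r : ℝ}

/-- Right continuity of the distribution function makes the infimum attained. -/
theorem quantile_le_iff (hc : 0 < c) (hc' : c < 1) : quantile μ c ≤ r ↔ c ≤ cdf μ r := by
  rw [quantile, if_pos ⟨hc, hc'⟩]
  have hne : {t | c ≤ cdf μ t}.Nonempty :=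
    (((tendsto_cdf_atTop μ).eventually (eventually_gt_nhds hc')).exists).imp fun _ h => h.le
  have hbdd : BddBelow {t | c ≤ cdf μ t} := by
    obtain ⟨t, ht⟩ := ((tendsto_cdf_atBot μ).eventually (eventually_lt_nhds hc)).exists
    refine ⟨t, fun u hu => ?_⟩
    by_contra hlt
    exact absurd (ht.trans_le hu) (monotone_cdf μ (not_le.1 hlt).le).not_gt
  refine ⟨fun h => ?_, fun h => csInf_le hbdd h⟩
  refine le_trans ?_ (monotone_cdf μ h)
  refine ge_of_tendsto (((cdf μ).right_continuous (sInf {t | c ≤ cdf μ t})).mono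
    Set.Ioi_subset_Ici_self) ?_
  filter_upwards [self_mem_nhdsWithin] with u hu
  obtain ⟨t, ht, htu⟩ := exists_lt_of_csInf_lt hne hu
  exact ht.trans (monotone_cdf μ htu.le)

theorem quantile_mono {c' : ℝ} (hc : 0 < c) (hcc : c ≤ c') (hc' : c' < 1) :
    quantile μ c ≤ quantile μ c' :=
  (quantile_le_iff hc (hcc.trans_lt hc')).2
    (hcc.trans ((quantile_le_iff (hc.trans_le hcc) hc').1 le_rfl))

/-- An atom at `s` opens a gap between the two masses; any rational in the gap exhibits `s` as a
rational quantile. -/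
theorem quantile_eq [IsProbabilityMeasure μ] {s : ℝ} (hc : 0 < c) (hc' : c < 1)
    (h : c ≤ cdf μ s) (h' : μ.real (Set.Iio s) < c) : quantile μ c = s := by
  refine le_antisymm ((quantile_le_iff hc hc').2 h) (le_of_forall_lt fun r hr => ?_)
  by_contra hle
  rw [not_lt, quantile_le_iff hc hc', cdf_eq_real] at hle
  have : μ.real (Set.Iic r) ≤ μ.real (Set.Iio s) :=
    measureReal_mono fun u hu => lt_of_le_of_lt hu hr
  linarith

/-- A measure is atomless as soon as its rational quantiles are not atoms. -/
theorem nullSingletonClass_of_quantile [IsProbabilityMeasure μ]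
    (h : ∀ c : ℚ, μ {quantile μ c} = 0) : NullSingletonClass μ := by
  refine ⟨fun s => ?_⟩
  by_contra hs
  have hsum : μ.real (Set.Iic s) = μ.real (Set.Iio s) + μ.real {s} := by
    rw [← Set.Iio_union_right, measureReal_union (by simp) (measurableSet_singleton s)]
  have hpos : 0 < μ.real {s} := by
    rw [measureReal_def]; exact ENNReal.toReal_pos hs (measure_ne_top _ _)
  obtain ⟨c, h1, h2⟩ := exists_rat_btwn (show μ.real (Set.Iio s) < μ.real (Set.Iic s) by linarith)
  have h0 : 0 < (c : ℝ) := measureReal_nonneg.trans_lt h1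
  have h3 : (c : ℝ) < 1 := h2.trans_le measureReal_le_one
  apply hs
  rw [← quantile_eq h0 h3 (by rw [cdf_eq_real]; exact h2.le) h1]
  exact h c

theorem continuous_cdf [IsProbabilityMeasure μ] [NullSingletonClass μ] : Continuous (cdf μ) := by
  refine continuous_iff_continuousAt.2 fun s => ?_
  rw [(monotone_cdf μ).continuousAt_iff_leftLim_eq_rightLim, (cdf μ).rightLim_eq]
  have h := (cdf μ).measure_singleton s
  rw [measure_cdf, measure_singleton, eq_comm, ENNReal.ofReal_eq_zero] at h
  exact le_antisymm ((monotone_cdf μ).leftLim_le le_rfl) (by linarith)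

/-- The set is a closed half-line, and by the intermediate value theorem the distribution function
equals `c` at its end. -/
theorem measureReal_cdf_le_of_mem_Ioo [IsProbabilityMeasure μ] [NullSingletonClass μ] (hc : 0 < c)
    (hc' : c < 1) : μ.real {s | cdf μ s ≤ c} = c := by
  obtain ⟨s₁, h1⟩ := ((tendsto_cdf_atTop μ).eventually (eventually_gt_nhds hc')).exists
  obtain ⟨s₀, h0⟩ := ((tendsto_cdf_atBot μ).eventually (eventually_lt_nhds hc)).exists
  obtain ⟨s, hs⟩ := mem_range_of_exists_le_of_exists_ge continuous_cdf ⟨s₀, h0.le⟩ ⟨s₁, h1.le⟩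
  have hbdd : BddAbove {s | cdf μ s ≤ c} := by
    refine ⟨s₁, fun u hu => ?_⟩
    by_contra hlt
    exact absurd (h1.trans_le (monotone_cdf μ (not_le.1 hlt).le)) (not_lt.2 hu)
  have hcl : IsClosed {s | cdf μ s ≤ c} := isClosed_le continuous_cdf continuous_const
  have hmem := hcl.csSup_mem ⟨s, hs.le⟩ hbdd
  have heq : {s | cdf μ s ≤ c} = Set.Iic (sSup {s | cdf μ s ≤ c}) :=
    Set.Subset.antisymm (fun u hu => le_csSup hbdd hu)
      (fun u hu => (monotone_cdf μ hu).trans hmem)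
  rw [heq, ← cdf_eq_real]
  exact le_antisymm hmem (hs.ge.trans (monotone_cdf μ (le_csSup hbdd hs.le)))

/-- The law of the distribution function of an atomless measure is uniform. -/
theorem measureReal_cdf_le [IsProbabilityMeasure μ] [NullSingletonClass μ] (hc : 0 ≤ c) (hc' : c ≤ 1) :
    μ.real {s | cdf μ s ≤ c} = c := by
  rcases hc'.eq_or_lt with rfl | hc'
  · simp [cdf_le_one]
  rcases hc.eq_or_lt with rfl | hc
  -- At level `0` the half-line may be empty, so small positive levels are used instead.
  · refine le_antisymm (le_of_forall_pos_le_add fun ε hε => ?_) measureReal_nonneg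
    have hm : 0 < min ε (1 / 2) := lt_min hε (by norm_num)
    have hm' : min ε (1 / 2) < 1 := (min_le_right _ _).trans_lt (by norm_num)
    calc μ.real {s | cdf μ s ≤ 0} ≤ μ.real {s | cdf μ s ≤ min ε (1 / 2)} :=
          measureReal_mono fun s hs => le_trans hs hm.le
      _ = min ε (1 / 2) := measureReal_cdf_le_of_mem_Ioo hm hm'
      _ ≤ 0 + ε := by simp
  · exact measureReal_cdf_le_of_mem_Ioo hc hc'

theorem ae_cdf_mem_Ioo [IsProbabilityMeasure μ] [NullSingletonClass μ] :
    ∀ᵐ s ∂μ, 0 < cdf μ s ∧ cdf μ s < 1 := by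
  refine Filter.Eventually.and ?_ ?_
  · have h : μ.real {s | cdf μ s ≤ 0} = 0 := measureReal_cdf_le le_rfl zero_le_one
    rw [measureReal_eq_zero_iff] at h
    simpa only [ae_iff, not_lt] using h
  · rw [ae_iff]
    simp only [not_lt]
    rw [← measureReal_eq_zero_iff]
    refine le_antisymm (le_of_forall_pos_le_add fun ε hε => ?_) measureReal_nonneg
    have hm : 0 < min ε (1 / 2) := lt_min hε (by norm_num)
    have hm' : min ε (1 / 2) ≤ 1 / 2 := min_le_right _ _
    have h := measureReal_cdf_le (μ := μ) (c := 1 - min ε (1 / 2)) (by linarith) (by linarith)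
    have hms : MeasurableSet {s | cdf μ s ≤ 1 - min ε (1 / 2)} :=
      (monotone_cdf μ).measurable measurableSet_Iic
    calc μ.real {s | 1 ≤ cdf μ s} ≤ μ.real {s | cdf μ s ≤ 1 - min ε (1 / 2)}ᶜ :=
          measureReal_mono fun s hs => by
            simp only [Set.mem_compl_iff, Set.mem_ofPred_eq, not_le] at hs ⊢
            linarith
      _ = min ε (1 / 2) := by rw [measureReal_compl hms, h]; simp
      _ ≤ 0 + ε := by simp

/-- The monotone rearrangement of an atomless measure. -/
theorem map_quantile_cdf [IsProbabilityMeasure μ] [NullSingletonClass μ] [IsProbabilityMeasure ν]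
    (hm : Measurable fun s => quantile ν (cdf μ s)) :
    μ.map (fun s => quantile ν (cdf μ s)) = ν := by
  have := Measure.isProbabilityMeasure_map (μ := μ) hm.aemeasurable
  refine Measure.ext_of_Iic _ _ fun r => ?_
  rw [Measure.map_apply hm measurableSet_Iic]
  have h1 : μ ((fun s => quantile ν (cdf μ s)) ⁻¹' Set.Iic r) = μ {s | cdf μ s ≤ cdf ν r} := by
    refine measure_congr ?_
    filter_upwards [ae_cdf_mem_Ioo (μ := μ)] with s hs
    exact propext (quantile_le_iff hs.1 hs.2)
  have h2 := measureReal_cdf_le (μ := μ) (cdf_nonneg ν r) (cdf_le_one ν r)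
  rw [h1, ← ofReal_measureReal, h2, ofReal_cdf]

end Quantile

/-! ### Measurable dependence on the fibre, and fibrewise rearrangement. -/

section Kernel

open ProbabilityTheory

variable {α : Type*} [MeasurableSpace α]

theorem measurable_cdf_kernel (κ : Kernel α ℝ) [IsMarkovKernel κ] :
    Measurable fun p : α × ℝ => cdf (κ p.1) p.2 := by
  have ht : MeasurableSet {p : (α × ℝ) × ℝ | p.2 ≤ p.1.2} :=
    measurableSet_le measurable_snd (measurable_snd.comp measurable_fst)
  have := (Kernel.measurable_kernel_prodMk_left (κ := κ.comap Prod.fst measurable_fst)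
    ht).ennreal_toReal
  convert this using 2 with p
  rw [cdf_eq_real]
  rfl

theorem measurable_quantile_kernel (κ : Kernel α ℝ) [IsMarkovKernel κ] :
    Measurable fun p : α × ℝ => quantile (κ p.1) p.2 := by
  refine measurable_of_Iic fun r => ?_
  have hI : MeasurableSet {p : α × ℝ | 0 < p.2 ∧ p.2 < 1} :=
    measurable_snd (measurableSet_Ioo (a := (0 : ℝ)) (b := 1))
  have hA : MeasurableSet {p : α × ℝ | p.2 ≤ cdf (κ p.1) r} :=
    measurableSet_le measurable_snd
      ((measurable_cdf_kernel κ).comp (measurable_fst.prodMk measurable_const))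
  have : (fun p : α × ℝ => quantile (κ p.1) p.2) ⁻¹' Set.Iic r =
      ({p : α × ℝ | 0 < p.2 ∧ p.2 < 1} ∩ {p : α × ℝ | p.2 ≤ cdf (κ p.1) r}) ∪
      ({p : α × ℝ | 0 < p.2 ∧ p.2 < 1}ᶜ ∩ {p : α × ℝ | 0 ≤ r}) := by
    ext ⟨a, c⟩
    by_cases hc : 0 < c ∧ c < 1
    · simp [hc, quantile_le_iff hc.1 hc.2]
    · simp [hc, quantile]
  rw [this]
  exact (hI.inter hA).union (hI.compl.inter (MeasurableSet.const _))

/-- Fibrewise monotone rearrangement: if `ρ` is a measure on triples `(q, s, t)` with `t ≤ s` whose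
`(q, s)`-marginal does not charge graphs, then the `(q, s)`-marginal is sent to the `(q, t)`-marginal
by a map which is monotone in each fibre and moves points down. -/
theorem exists_fibrewise_rearrangement (ρ : Measure (α × ℝ × ℝ)) [IsFiniteMeasure ρ]
    (hle : ∀ᵐ p ∂ρ, p.2.2 ≤ p.2.1)
    (hgraph : ∀ f : α → ℝ, Measurable f → ρ {p | p.2.1 = f p.1} = 0) :
    ∃ τ : α × ℝ → ℝ, Measurable τ ∧
      ρ.map (fun p => (p.1, τ (p.1, p.2.1))) = ρ.map (fun p => (p.1, p.2.2)) ∧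
      ∃ G : Set (α × ℝ), MeasurableSet G ∧ (∀ᵐ p ∂ρ, (p.1, p.2.1) ∈ G) ∧ (∀ p ∈ G, τ p ≤ p.2) ∧
        ∀ q s s', (q, s) ∈ G → (q, s') ∈ G → s ≤ s' → τ (q, s) ≤ τ (q, s') := by
  obtain ⟨κ, hκ, hρ⟩ : ∃ κ : Kernel α (ℝ × ℝ), IsMarkovKernel κ ∧ ρ.fst ⊗ₘ κ = ρ :=
    ⟨ρ.condKernel, inferInstance, ρ.disintegrate _⟩
  obtain ⟨κ₀, hm₀, hκ₀⟩ : ∃ κ₀ : Kernel α ℝ, IsMarkovKernel κ₀ ∧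
      ∀ q, κ₀ q = (κ q).map Prod.fst :=
    ⟨κ.map Prod.fst, Kernel.IsMarkovKernel.map _ measurable_fst,
      Kernel.map_apply _ measurable_fst⟩
  obtain ⟨κ₁, hm₁, hκ₁⟩ : ∃ κ₁ : Kernel α ℝ, IsMarkovKernel κ₁ ∧
      ∀ q, κ₁ q = (κ q).map Prod.snd :=
    ⟨κ.map Prod.snd, Kernel.IsMarkovKernel.map _ measurable_snd,
      Kernel.map_apply _ measurable_snd⟩
  have hκ₀' : ∀ q S, MeasurableSet S → κ₀ q S = κ q (Prod.fst ⁻¹' S) := fun q S hS => by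
    rw [hκ₀, Measure.map_apply measurable_fst hS]
  have hκ₁' : ∀ q S, MeasurableSet S → κ₁ q S = κ q (Prod.snd ⁻¹' S) := fun q S hS => by
    rw [hκ₁, Measure.map_apply measurable_snd hS]
  have hae : ∀ {p : α × ℝ × ℝ → Prop}, MeasurableSet {x | p x} →
      ((∀ᵐ x ∂ρ, p x) ↔ ∀ᵐ q ∂ρ.fst, ∀ᵐ x ∂κ q, p (q, x)) := fun {p} hp => by
    conv_lhs => rw [← hρ]
    exact Measure.ae_compProd_iff hp
  -- Stochastic domination in almost every fibre; this is what makes `τ` move points down.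
  have hle' : ∀ᵐ q ∂ρ.fst, ∀ s, cdf (κ₀ q) s ≤ cdf (κ₁ q) s := by
    filter_upwards [(hae (measurableSet_le (by fun_prop) (by fun_prop))).1 hle] with q hq s
    rw [cdf_eq_real, cdf_eq_real, measureReal_def, measureReal_def]
    refine ENNReal.toReal_mono (measure_ne_top _ _) ?_
    rw [hκ₀' _ _ measurableSet_Iic, hκ₁' _ _ measurableSet_Iic]
    refine measure_mono_ae ?_
    filter_upwards [hq] with p hp hps
    exact le_trans hp hps
  have hna : ∀ᵐ q ∂ρ.fst, NullSingletonClass (κ₀ q) := by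
    -- Each rational quantile is a measurable function of `q`, so `hgraph` applies to its graph.
    have h : ∀ c : ℚ, ∀ᵐ q ∂ρ.fst, κ₀ q {quantile (κ₀ q) c} = 0 := fun c => by
      have hf : Measurable fun q => quantile (κ₀ q) c :=
        (measurable_quantile_kernel κ₀).comp (measurable_id.prodMk measurable_const)
      have h0 : ∀ᵐ p ∂ρ, p.2.1 ≠ quantile (κ₀ p.1) c := by
        rw [ae_iff]; simpa using hgraph _ hf
      filter_upwards [(hae (measurableSet_eq_fun (by fun_prop)
        (hf.comp measurable_fst)).compl).1 h0] with q hq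
      rw [hκ₀' _ _ (measurableSet_singleton _)]
      rw [ae_iff] at hq
      refine Eq.trans (congrArg _ ?_) hq
      ext x
      exact not_not.symm
    filter_upwards [ae_all_iff.2 h] with q hq
    exact nullSingletonClass_of_quantile hq
  obtain ⟨τ, hτdef⟩ : ∃ τ : α × ℝ → ℝ, τ = fun p => quantile (κ₁ p.1) (cdf (κ₀ p.1) p.2) :=
    ⟨_, rfl⟩
  have hτ : Measurable τ := by
    rw [hτdef]
    exact (measurable_quantile_kernel κ₁).comp (measurable_fst.prodMk (measurable_cdf_kernel κ₀))
  have hcm := measurable_cdf_kernel κ₀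
  -- `G` records the pointwise conditions under which `τ` is a true quantile and moves down, so that
  -- both properties hold everywhere on `G`.
  refine ⟨τ, hτ, ?_, {p | (0 < cdf (κ₀ p.1) p.2 ∧ cdf (κ₀ p.1) p.2 < 1) ∧
    cdf (κ₀ p.1) p.2 ≤ cdf (κ₁ p.1) p.2}, ?_, ?_, ?_, ?_⟩
  · have e1 : Measurable fun p : α × ℝ × ℝ => (p.1, τ (p.1, p.2.1)) := by fun_prop
    have e2 : Measurable fun p : α × ℝ × ℝ => (p.1, p.2.2) := by fun_prop
    refine Measure.ext fun S hS => ?_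
    rw [Measure.map_apply e1 hS, Measure.map_apply e2 hS]
    conv_lhs => rw [← hρ]
    conv_rhs => rw [← hρ]
    rw [Measure.compProd_apply (e1 hS), Measure.compProd_apply (e2 hS)]
    refine lintegral_congr_ae ?_
    filter_upwards [hna] with q hq
    have hτq : Measurable fun s => τ (q, s) := hτ.comp measurable_prodMk_left
    have hSq : MeasurableSet (Prod.mk q ⁻¹' S) := measurable_prodMk_left hS
    have h : (κ₀ q).map (fun s => τ (q, s)) = κ₁ q := by
      have hτq' : (fun s => τ (q, s)) = fun s => quantile (κ₁ q) (cdf (κ₀ q) s) := by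
        rw [hτdef]
      rw [hτq'] at hτq ⊢
      exact map_quantile_cdf hτq
    have h' : κ₀ q ((fun s => τ (q, s)) ⁻¹' (Prod.mk q ⁻¹' S)) = κ₁ q (Prod.mk q ⁻¹' S) :=
      (Measure.map_apply hτq hSq).symm.trans (by rw [h])
    rw [hκ₀' _ _ (hτq hSq), hκ₁' _ _ hSq] at h'
    exact h'
  · exact ((measurableSet_lt measurable_const hcm).inter
      (measurableSet_lt hcm measurable_const)).inter
      (measurableSet_le hcm (measurable_cdf_kernel κ₁))
  · have e3 : ∀ κ' : Kernel α ℝ, IsMarkovKernel κ' →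
        Measurable fun p : α × ℝ × ℝ => cdf (κ' p.1) p.2.1 := fun κ' _ =>
      (measurable_cdf_kernel κ').comp (g := fun p : α × ℝ => cdf (κ' p.1) p.2)
        (f := fun p : α × ℝ × ℝ => (p.1, p.2.1)) (by fun_prop)
    have f0 := e3 κ₀ hm₀
    have f1 := e3 κ₁ hm₁
    refine (hae (((measurableSet_lt measurable_const f0).inter
      (measurableSet_lt f0 measurable_const)).inter (measurableSet_le f0 f1))).2 ?_
    filter_upwards [hna, hle'] with q hq hq'
    have h := ae_of_ae_map (μ := κ q) (f := Prod.fst) measurable_fst.aemeasurable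
      (p := fun s => 0 < cdf (κ₀ q) s ∧ cdf (κ₀ q) s < 1)
      (by rw [← hκ₀ q]; exact ae_cdf_mem_Ioo)
    filter_upwards [h] with p hp
    exact ⟨hp, hq' _⟩
  · rintro p ⟨⟨h0, h1⟩, h2⟩
    rw [hτdef]
    exact (quantile_le_iff h0 h1).2 h2
  · rintro q s s' ⟨⟨h0, -⟩, -⟩ ⟨⟨-, h1⟩, -⟩ hss
    rw [hτdef]
    exact quantile_mono h0 (monotone_cdf _ hss) h1

end Kernel

end L1Transport

namespace L1Transport

/-! ### Existence of an optimal plan by the direct method. -/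

section Existence

open Filter Topology BoundedContinuousFunction

variable {X : Type*} [MeasurableSpace X]

theorem isProbabilityMeasure_of_mem_plans {μ₀ μ₁ : Measure X} [IsProbabilityMeasure μ₀]
    {π : Measure (X × X)} (hπ : π ∈ plans μ₀ μ₁) : IsProbabilityMeasure π := by
  refine ⟨?_⟩
  have h := measure_univ (μ := μ₀)
  rwa [← hπ.1, Measure.map_apply measurable_fst MeasurableSet.univ] at h

variable [MetricSpace X] [ProperSpace X] [BorelSpace X]

/-- The transport cost is lower semicontinuous for weak convergence. -/
theorem lowerSemicontinuous_cost :
    LowerSemicontinuous fun π : ProbabilityMeasure (X × X) => cost (π : Measure (X × X)) := by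
  -- The truncated distances increase to the distance, and their integrals are weakly continuous.
  let f : ℕ → (X × X →ᵇ NNReal) := fun n =>
    BoundedContinuousFunction.mkOfBound ⟨fun p => min (nndist p.1 p.2) n, by fun_prop⟩ n
      fun p q => by
        rw [NNReal.dist_eq]
        have h : ∀ p : X × X, ((min (nndist p.1 p.2) n : NNReal) : ℝ) ∈ Set.Icc (0 : ℝ) n :=
          fun p => ⟨NNReal.coe_nonneg _, by exact_mod_cast min_le_right _ _⟩
        have h1 := h p
        have h2 := h q
        exact abs_sub_le_iff.2 ⟨(sub_le_self _ h2.1).trans h1.2, (sub_le_self _ h1.1).trans h2.2⟩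
  have hf : ∀ n p, f n p = min (nndist p.1 p.2) n := fun n p => rfl
  have hsup : ∀ p : X × X, edist p.1 p.2 = ⨆ n, (f n p : ENNReal) := fun p => by
    refine le_antisymm ?_ (iSup_le fun n => ?_)
    · obtain ⟨n, hn⟩ := exists_nat_ge (nndist p.1 p.2)
      refine le_iSup_of_le n ?_
      rw [hf, min_eq_left hn, edist_nndist]
    · rw [edist_nndist]
      exact_mod_cast min_le_left _ _
  have hcost : ∀ π : ProbabilityMeasure (X × X),
      cost (π : Measure (X × X)) = ⨆ n, ∫⁻ p, f n p ∂(π : Measure (X × X)) := fun π => by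
    rw [cost, lintegral_congr hsup, lintegral_iSup]
    · exact fun n => (ENNReal.continuous_coe.comp (f n).continuous).measurable
    · intro m n hmn p
      simp only [hf]
      exact_mod_cast min_le_min_left _ (Nat.cast_le.2 hmn)
  simp only [hcost]
  exact lowerSemicontinuous_iSup fun n =>
    (ProbabilityMeasure.continuous_lintegral_boundedContinuousFunction (f n)).lowerSemicontinuous

/-- The mass outside `K ×ˢ L` is controlled by the marginals, which are the same for all plans. -/
theorem isTightMeasureSet_plans (μ₀ μ₁ : Measure X) [IsProbabilityMeasure μ₀]
    [IsProbabilityMeasure μ₁] : IsTightMeasureSet (plans μ₀ μ₁) := by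
  rw [isTightMeasureSet_iff_exists_isCompact_measure_compl_le]
  intro ε hε
  have hε2 : 0 < ε / 2 := ENNReal.half_pos hε.ne'
  obtain ⟨K, hK, h1⟩ := isTightMeasureSet_iff_exists_isCompact_measure_compl_le.1
    (isTightMeasureSet_singleton (μ := μ₀)) _ hε2
  obtain ⟨L, hL, h2⟩ := isTightMeasureSet_iff_exists_isCompact_measure_compl_le.1
    (isTightMeasureSet_singleton (μ := μ₁)) _ hε2
  refine ⟨K ×ˢ L, hK.prod hL, fun π hπ => ?_⟩
  have e1 := h1 μ₀ rfl
  have e2 := h2 μ₁ rfl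
  rw [← hπ.1, Measure.map_apply measurable_fst hK.measurableSet.compl] at e1
  rw [← hπ.2, Measure.map_apply measurable_snd hL.measurableSet.compl] at e2
  calc π (K ×ˢ L)ᶜ ≤ π (Prod.fst ⁻¹' Kᶜ ∪ Prod.snd ⁻¹' Lᶜ) := by
        refine measure_mono fun p hp => ?_
        by_contra hc
        simp only [Set.mem_union, Set.mem_preimage, Set.mem_compl_iff, not_or, not_not] at hc
        exact hp hc
    _ ≤ ε / 2 + ε / 2 := (measure_union_le _ _).trans (add_le_add e1 e2)
    _ = ε := ENNReal.add_halves ε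

theorem exists_isOptimalPlan (μ₀ μ₁ : Measure X) [IsProbabilityMeasure μ₀]
    [IsProbabilityMeasure μ₁] : ∃ π, IsOptimalPlan μ₀ μ₁ π := by
  let S : Set (ProbabilityMeasure (X × X)) := {π | (π : Measure (X × X)) ∈ plans μ₀ μ₁}
  let ν₀ : ProbabilityMeasure X := ⟨μ₀, inferInstance⟩
  let ν₁ : ProbabilityMeasure X := ⟨μ₁, inferInstance⟩
  have hS : IsClosed S := by
    have c1 := ProbabilityMeasure.continuous_map (continuous_fst (X := X) (Y := X))
    have c2 := ProbabilityMeasure.continuous_map (continuous_snd (X := X) (Y := X))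
    have : S = {π | π.map continuous_fst.measurable.aemeasurable = ν₀} ∩
        {π | π.map continuous_snd.measurable.aemeasurable = ν₁} := by
      ext π
      simp only [Set.mem_inter_iff, Set.mem_ofPred_eq]
      rw [← ProbabilityMeasure.toMeasure_injective.eq_iff,
        ← ProbabilityMeasure.toMeasure_injective.eq_iff]
      exact Iff.rfl
    rw [this]
    exact (isClosed_eq c1 continuous_const).inter (isClosed_eq c2 continuous_const)
  have hc : IsCompact S := by
    rw [← hS.closure_eq]
    refine isCompact_closure_of_isTightMeasureSet ((isTightMeasureSet_plans μ₀ μ₁).subset ?_)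
    rintro _ ⟨π, hπ, rfl⟩
    exact hπ
  have hne : S.Nonempty :=
    ⟨⟨μ₀.prod μ₁, inferInstance⟩, by
      constructor <;> simp [Measure.map_fst_prod, Measure.map_snd_prod]⟩
  obtain ⟨π, hπ, hmin⟩ := lowerSemicontinuous_cost.lowerSemicontinuousOn S |>.exists_isMinOn hne hc
  refine ⟨π, hπ, fun π' hπ' => ?_⟩
  exact hmin (show (⟨π', isProbabilityMeasure_of_mem_plans hπ'⟩ : ProbabilityMeasure _) ∈ S from hπ')

end Existence

end L1Transport

namespace L1Transport

/-! ### From a plan on `Γ` to a monotone map. -/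

section Monge

variable {X : Type*} [MetricSpace X] [ProperSpace X] [MeasurableSpace X] [BorelSpace X] {φ : X → ℝ}

/-- A plan concentrated on `Γ` can be replaced by a map which is monotone along the rays, as soon
as its first marginal charges neither the branching points nor the Borel sets meeting each ray in
at most one point. -/
theorem exists_monotone_map (hgeo : GeodesicSpace X) (hnb : NonBranching X)
    (hφ : LipschitzWith 1 φ) (π : Measure (X × X)) [IsFiniteMeasure π] (hπ : ∀ᵐ p ∂π, p ∈ Gam φ)
    (hbr : ∀ᵐ p ∂π, p.1 ∈ transportSet φ ∨ p.1 ∉ transportSetEnd φ)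
    (hsub : ∀ A, MeasurableSet A → A ⊆ transportSet φ →
      (∀ x ∈ A, ∀ x' ∈ A, (x, x') ∈ Rays φ → x = x') → π (Prod.fst ⁻¹' A) = 0) :
    ∃ T : X → X, Measurable T ∧ π.map (fun p => T p.1) = π.map Prod.snd ∧
      ∃ E : Set X, MeasurableSet E ∧ (∀ᵐ p ∂π, p.1 ∈ E) ∧ (∀ x ∈ E, (x, T x) ∈ Gam φ) ∧
        ∀ x ∈ E, ∀ x' ∈ E, (x, x') ∈ Gam φ → (T x, T x') ∈ Gam φ := by
  classical
  have hφc := hφ.continuous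
  have hφm : Measurable φ := hφc.measurable
  obtain ⟨Q, hQ, hQmem, hQeq⟩ := exists_rayBase hgeo hnb hφ
  have hTm := measurableSet_transportSet hφc
  have hA : MeasurableSet (Prod.fst ⁻¹' transportSet φ : Set (X × X)) := measurable_fst hTm
  -- Only the part of the plan starting in `𝒯` has to be rearranged; the rest is almost surely on
  -- the diagonal.
  obtain ⟨π', hπ'⟩ : ∃ π', π' = π.restrict (Prod.fst ⁻¹' transportSet φ) := ⟨_, rfl⟩
  have hfin : IsFiniteMeasure π' := by rw [hπ']; infer_instance
  have hπ'le : π' ≤ π := hπ' ▸ Measure.restrict_le_self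
  have hπ'T : ∀ᵐ p ∂π', p.1 ∈ transportSet φ := by rw [hπ']; exact ae_restrict_mem hA
  have hπ'Γ : ∀ᵐ p ∂π', p ∈ Gam φ := hπ.filter_mono (ae_mono hπ'le)
  have hΨ : Measurable fun p : X × X => (Q p.1, φ p.1, φ p.2) := by fun_prop
  obtain ⟨τ, hτ, hmap, G, hG, hGae, hGle, hGmono⟩ := exists_fibrewise_rearrangement
    (π'.map fun p : X × X => (Q p.1, φ p.1, φ p.2))
    (by
      rw [ae_map_iff hΨ.aemeasurable (measurableSet_le (by fun_prop) (by fun_prop))]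
      filter_upwards [hπ'Γ] with p hp using le_of_Gam hp)
    (fun f hf => by
      have hS : MeasurableSet {x | φ x = f (Q x)} := measurableSet_eq_fun hφm (hf.comp hQ)
      have hS' : MeasurableSet {p : X × ℝ × ℝ | p.2.1 = f p.1} :=
        measurableSet_eq_fun (by fun_prop) (hf.comp measurable_fst)
      rw [Measure.map_apply hΨ hS', hπ', Measure.restrict_apply (hΨ hS')]
      refine measure_mono_null ?_ (hsub ({x | φ x = f (Q x)} ∩ transportSet φ) (hS.inter hTm)
        Set.inter_subset_right ?_)
      · exact fun p hp => hp
      · rintro x ⟨hx, hxT⟩ x' ⟨hx', hxT'⟩ h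
        refine eq_of_Rays h ?_
        rw [Set.mem_ofPred_eq] at hx hx'
        rw [hx, hx', hQeq x hxT x' hxT' h])
  have hg : Measurable fun x => (Q x, τ (Q x, φ x)) := by fun_prop
  have hg' : Measurable fun p : X × X => (Q p.1, φ p.2) := by fun_prop
  have hmap' : π'.map (fun p => (Q p.1, τ (Q p.1, φ p.1))) = π'.map (fun p => (Q p.1, φ p.2)) := by
    rw [Measure.map_map (by fun_prop) hΨ, Measure.map_map (by fun_prop) hΨ] at hmap
    exact hmap
  have hray : ∀ᵐ p ∂π', (Q p.1, p.2) ∈ Rays φ := by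
    filter_upwards [hπ'T, hπ'Γ] with p hp hp'
    exact Rays_trans hφ hp (Rays_symm (hQmem _ hp).2) (Rays_of_Gam hp')
  -- The rearranged level is attained on the ray: by `hmap'` its law with `Q` is that of actual
  -- target levels.
  have hlev : ∀ᵐ p ∂π', (Q p.1, τ (Q p.1, φ p.1)) ∈ rayLevels φ := by
    have h : ∀ᵐ z ∂(π'.map fun p => (Q p.1, φ p.2)), z ∈ rayLevels φ := by
      refine (ae_map_iff hg'.aemeasurable (p := fun z => z ∈ rayLevels φ)
        (measurableSet_rayLevels hφc)).2 ?_
      filter_upwards [hray] with p hp using ⟨p.2, hp, rfl⟩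
    rw [← hmap'] at h
    exact ae_of_ae_map (hg.comp measurable_fst).aemeasurable h
  have hP := measurable_rayPoint hφ
  let T : X → X := fun x => if x ∈ transportSet φ then rayPoint φ (x, τ (Q x, φ x)) else x
  have hT : Measurable T := Measurable.ite hTm (hP.comp (by fun_prop)) measurable_id
  have hTpos : ∀ {x}, x ∈ transportSet φ → T x = rayPoint φ (x, τ (Q x, φ x)) := fun h => if_pos h
  have hTneg : ∀ {x}, x ∉ transportSet φ → T x = x := fun h => if_neg h
  refine ⟨T, hT, ?_, {x | (x ∈ transportSet φ ∨ x ∉ transportSetEnd φ) ∧ (x ∈ transportSet φ →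
    (Q x, φ x) ∈ G ∧ (Q x, τ (Q x, φ x)) ∈ rayLevels φ)}, ?_, ?_, ?_, ?_⟩
  · have hTf : Measurable fun p : X × X => T p.1 := hT.comp measurable_fst
    rw [← Measure.restrict_add_restrict_compl (μ := π) hA, Measure.map_add _ _ hTf,
      Measure.map_add _ _ measurable_snd, ← hπ']
    congr 1
    · calc π'.map (fun p => T p.1)
          = π'.map (rayPoint φ ∘ fun p => (Q p.1, τ (Q p.1, φ p.1))) := by
            refine Measure.map_congr ?_
            filter_upwards [hπ'T, hlev] with p hp hl
            obtain ⟨h1, h2⟩ := hQmem _ hp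
            rw [hTpos hp, Function.comp_apply, rayPoint_congr hφ h1 hp (Rays_symm h2) hl]
        _ = π'.map (rayPoint φ ∘ fun p => (Q p.1, φ p.2)) := by
            rw [← Measure.map_map hP hg', ← hmap', Measure.map_map hP (by fun_prop)]
        _ = π'.map Prod.snd := by
            refine Measure.map_congr ?_
            filter_upwards [hπ'T, hray] with p hp hr
            exact rayPoint_eq hφ (hQmem _ hp).1 hr
    · refine Measure.map_congr ?_
      filter_upwards [ae_restrict_mem hA.compl, ae_restrict_of_ae hbr, ae_restrict_of_ae hπ]
        with p hp hb hpΓ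
      rw [hTneg hp]
      by_contra hne
      exact (hb.resolve_left hp) (mem_transportSetEnd.2 ⟨p.2, hne, Rays_of_Gam hpΓ⟩)
  · have hQφ : Measurable fun x => (Q x, φ x) := by fun_prop
    exact (hTm.union (measurableSet_transportSetEnd hφc).compl).inter
      (hTm.imp ((hQφ hG).inter (hg (measurableSet_rayLevels hφc))))
  · have h1 : ∀ᵐ p ∂π', (Q p.1, φ p.1) ∈ G := ae_of_ae_map hΨ.aemeasurable hGae
    have h2 := h1.and hlev
    rw [hπ', ae_restrict_iff'₀ hA.nullMeasurableSet] at h2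
    filter_upwards [hbr, h2] with p hp hp' using ⟨hp, hp'⟩
  · rintro x ⟨hx, hx'⟩
    by_cases hxT : x ∈ transportSet φ
    · obtain ⟨h1, h2⟩ := hx' hxT
      obtain ⟨h3, h4⟩ := rayPoint_spec hφ hxT ((rayLevels_congr hφ hxT (hQmem x hxT).1
        (hQmem x hxT).2).2 h2)
      rw [hTpos hxT]
      exact Gam_of_Rays h3 (h4.le.trans (hGle _ h1))
    · rw [hTneg hxT]
      exact Gam_refl x
  · rintro x ⟨hx, hxE⟩ x' ⟨hx', hxE'⟩ h
    rcases eq_or_ne x x' with rfl | hne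
    · exact Gam_refl _
    have hxT := hx.resolve_right fun hc =>
      hc (mem_transportSetEnd.2 ⟨x', hne, Rays_of_Gam h⟩)
    have hxT' := hx'.resolve_right fun hc =>
      hc (mem_transportSetEnd.2 ⟨x, hne.symm, Rays_symm (Rays_of_Gam h)⟩)
    obtain ⟨h1, h2⟩ := hxE hxT
    obtain ⟨h1', h2'⟩ := hxE' hxT'
    obtain ⟨h3, h4⟩ := rayPoint_spec hφ hxT ((rayLevels_congr hφ hxT (hQmem x hxT).1
      (hQmem x hxT).2).2 h2)
    obtain ⟨h3', h4'⟩ := rayPoint_spec hφ hxT' ((rayLevels_congr hφ hxT' (hQmem x' hxT').1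
      (hQmem x' hxT').2).2 h2')
    rw [hTpos hxT, hTpos hxT']
    -- Both images lie on the common ray, so only their levels need comparing.
    refine Gam_of_Rays (Rays_trans hφ hxT (Rays_symm h3)
      (Rays_trans hφ hxT' (Rays_of_Gam h) h3')) ?_
    rw [h4, h4']
    have hq := hQeq x hxT x' hxT' (Rays_of_Gam h)
    rw [← hq] at h1' ⊢
    exact hGmono _ _ _ h1' h1 (le_of_Gam h)

end Monge

end L1Transport

theorem theorem6p2 {X : Type*} [MetricSpace X] [ProperSpace X] [MeasurableSpace X] [BorelSpace X]
    (hgeo : L1Transport.GeodesicSpace X) (hnb : L1Transport.NonBranching X)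
    (m : Measure X) [IsProbabilityMeasure m]
    (μ₀ μ₁ : Measure X) [IsProbabilityMeasure μ₀] [IsProbabilityMeasure μ₁]
    (hμ₀ : L1Transport.FiniteFirstMoment μ₀) (hμ₁ : L1Transport.FiniteFirstMoment μ₁)
    (hac : μ₀ ≪ m)
    (φ : X → ℝ) (hφ : L1Transport.IsKantorovichPotential μ₀ μ₁ φ)
    (hA1 : L1Transport.AssumptionA1 m φ) :
    ∃ T : X → X, Measurable T ∧ μ₀.map T = μ₁ ∧
      IsLeast (L1Transport.cost '' L1Transport.plans μ₀ μ₁) (∫⁻ x, edist x (T x) ∂μ₀) ∧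
      -- `T` moves points forward along the rays and is monotone along them
      ∃ E : Set X, μ₀ Eᶜ = 0 ∧ (∀ x ∈ E, (x, T x) ∈ L1Transport.Gam φ) ∧
        ∀ x ∈ E, ∀ x' ∈ E, (x, x') ∈ L1Transport.Gam φ → (T x, T x') ∈ L1Transport.Gam φ := by
  open L1Transport in
  obtain ⟨hL, hopt⟩ := hφ
  have hc := hL.continuous
  have hΓ : MeasurableSet (Gam φ) := (isClosed_Gam hc).measurableSet
  obtain ⟨π, hπ⟩ := exists_isOptimalPlan μ₀ μ₁
  have hprob := isProbabilityMeasure_of_mem_plans hπ.1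
  have hfst : ∀ S, MeasurableSet S → π (Prod.fst ⁻¹' S) = μ₀ S := fun S hS => by
    rw [← hπ.1.1, Measure.map_apply measurable_fst hS]
  have hnull : ∀ S, MeasurableSet S → m S = 0 → ∀ᵐ p ∂π, p.1 ∉ S := fun S hS h => by
    change ∀ᵐ p ∂π, p ∉ Prod.fst ⁻¹' S
    refine measure_eq_zero_iff_ae_notMem.1 ?_
    rw [hfst S hS]
    exact hac h
  obtain ⟨T, hT, hmap, E, hE, hEae, hE1, hE2⟩ := exists_monotone_map hgeo hnb hL π
    ((mem_ae_iff_prob_eq_one hΓ).2 ((hopt π hπ.1).1 hπ))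
    (by
      filter_upwards [hnull _ (measurableSet_branchForward hc)
        (measure_branchForward hgeo hnb hL hA1), hnull _ (measurableSet_branchBackward hc)
        (measure_branchBackward hgeo hnb hL hA1)] with p h1 h2
      by_cases h : p.1 ∈ transportSetEnd φ
      · exact Or.inl ⟨h, fun hc => hc.elim h1 h2⟩
      · exact Or.inr h)
    (fun A hA hAT h => by
      rw [hfst A hA]
      refine hac (measure_eq_zero_of_subsingleton_rays hc hA1 hA
        (hAT.trans transportSet_subset) ?_)
      exact fun x hx x' hx' y hy h1 h2 => h x hx x' hx' (Rays_trans hL hy h1 (Rays_symm h2)))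
  have hE0 : μ₀ Eᶜ = 0 := by
    rw [← hfst _ hE.compl]
    exact hEae
  have hTmap : μ₀.map T = μ₁ := by
    rw [← hπ.1.1, Measure.map_map hT measurable_fst, ← hπ.1.2]
    exact hmap
  have hg : Measurable fun x => (x, T x) := measurable_id.prodMk hT
  have hplan : μ₀.map (fun x => (x, T x)) ∈ plans μ₀ μ₁ := by
    refine ⟨?_, ?_⟩
    · rw [Measure.map_map measurable_fst hg]
      exact Measure.map_id
    · rw [Measure.map_map measurable_snd hg]
      exact hTmap
  -- The converse half of the potential property: concentration on `Γ` gives optimality.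
  have hopt' : IsOptimalPlan μ₀ μ₁ (μ₀.map fun x => (x, T x)) := by
    refine (hopt _ hplan).2 ?_
    rw [Measure.map_apply hg hΓ]
    refine (mem_ae_iff_prob_eq_one (hg hΓ)).1 ?_
    exact Filter.mem_of_superset (mem_ae_iff.2 hE0) hE1
  have hcost : cost (μ₀.map fun x => (x, T x)) = ∫⁻ x, edist x (T x) ∂μ₀ :=
    lintegral_map (measurable_fst.edist measurable_snd) hg
  refine ⟨T, hT, hTmap, ⟨⟨_, hplan, hcost⟩, ?_⟩, E, hE0, hE1, hE2⟩
  rintro _ ⟨π', hπ', rfl⟩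
  rw [← hcost]
  exact hopt'.2 π' hπ'
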